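/- Notation and definitions. $\mathbb{C}^n$ carries the Euclidean norm. For a real-valued $\mathcal{C}^2$ function $f$ on an open subset of $\mathbb{C}^n$, the complex Hessian is $H^{\mathbb{C}}f=\big[\partial^2 f/\partial z_k\partial\overline{z_\ell}\big]_{k,\ell=1}^n$. For Hermitian matrices, $\mathcal{A}\geq\mathcal{B}$ means that $\mathcal{A}-\mathcal{B}$ is positive semidefinite. An upper semicontinuous function $u:U\to[-\infty,\infty)$ on an open set $U\subset\mathbb{C}^m$ is *subpluriharmonic* on $U$ if either $u\equiv-\infty$ on $U$, or for every compact ball $\overline{B}\subset U$ (of positive radius) and every continuous plurisubharmonic function $h$ defined in a neighbourhood of $\overline{B}$, the sum $u+h$ attains its maximum over $\overline{B}$ at some point of the boundary $bB$. For an integer $q\geq 0$ and an open set $U\subset\mathbb{C}^n$, an upper semicontinuous function $u:U\to[-\infty,\infty)$ is *$q$-plurisubharmonic* on $U$, written $u\in\mathit{PSH}_q(U)$, if either $q\geq n$, or $q<n$ and $u$ is subpluriharmonic on $U\cap\pi$ for every $(q+1)$-dimensional complex affine subspace $\pi$ of $\mathbb{C}^n$ (identified with $\mathbb{C}^{q+1}$).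 For $X\subset\mathbb{C}^n$ non-empty and $v:X\to[-\infty,\infty)$, $\Phi:\mathbb{C}^n\to[-\infty,\infty)$ upper semicontinuous, the *sup-convolution* is $$v_X^\Phi(y)=\sup_{x\in X}\{v(x)+\Phi(y-x)\}\in[-\infty,\infty],\qquad y\in\mathbb{C}^n,$$ and its *proper set of definition* is the set of those $y\in\mathbb{C}^n$ for which there is $\hat{x}\in X$ with $v_X^\Phi(y)=v(\hat{x})+\Phi(y-\hat{x})$. **Proposition.** Let $\Phi:\mathbb{C}^n\to[-\infty,\infty)$ be upper semicontinuous, let $U\subset\mathbb{C}^n$ be a non-empty open set, let $\mathcal{A}\in\mathbb{C}^{n\times n}$ be a fixed Hermitian matrix, and let $g\in\mathcal{C}^2(U)$ be a real-valued function with $H^{\mathbb{C}}g\geq\mathcal{A}$ at every point of $U$. Let $q\geq0$ be an integer and $u\in\mathit{PSH}_q(U)$. Suppose that the proper set of definition of the sup-convolution $[u+g]_U^\Phi$ has non-empty interior $W$, and that the restriction of $[u+g]_U^\Phi$ to $W$ is upper semicontinuous. Then $[u+g]_U^\Phi-h$ lies in $\mathit{PSH}_q(W)$ for every real-valued $h\in\mathcal{C}^2(W)$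 with $H^{\mathbb{C}}h\leq\mathcal{A}$ at every point of $W$. -/

import Mathlib

open scoped ComplexOrder

noncomputable section

/-- `V` is meant to be open in a complex vector space.  A real-valued continuous function `h` is
plurisubharmonic on `V`: it satisfies the sub-mean value inequality on (the boundary of) every
closed disc `{a + ζ b : |ζ| ≤ 1}` of a complex line that is contained in `V`. -/
def IsContinuousPsh {E : Type*} [NormedAddCommGroup E] [NormedSpace ℂ E]
    (V : Set E) (h : E → ℝ) : Prop :=
  ContinuousOn h V ∧
    ∀ a b : E, (∀ ζ : ℂ, ‖ζ‖ ≤ 1 → a + ζ • b ∈ V) →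
      h a ≤ Real.circleAverage (fun ζ : ℂ => h (a + ζ • b)) 0 1

/-- Subpluriharmonicity of `u : U → [-∞, ∞)` on an open set `U`: either `u ≡ -∞` on `U`, or for
every compact ball in `U` and every continuous plurisubharmonic function `h` on a neighbourhood
`V` of that ball, the maximum of `u + h` over the ball is attained on the bounding sphere. -/
def IsSubpluriharmonic {E : Type*} [NormedAddCommGroup E] [NormedSpace ℂ E]
    (U : Set E) (u : E → EReal) : Prop :=
  (∀ z ∈ U, u z = ⊥) ∨
    ∀ (c : E) (r : ℝ), 0 < r → Metric.closedBall c r ⊆ U →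
      ∀ (V : Set E) (h : E → ℝ), IsOpen V → Metric.closedBall c r ⊆ V → IsContinuousPsh V h →
        ∃ p ∈ Metric.sphere c r, ∀ z ∈ Metric.closedBall c r,
          u z + (h z : EReal) ≤ u p + (h p : EReal)

/-- `u ∈ PSH_q(U)`: `u : U → [-∞, ∞)` is upper semicontinuous and, if `q < n`, it is
subpluriharmonic on `U ∩ π` for every complex affine subspace `π` of dimension `q + 1`.  The
subspaces `π` are given with a Euclidean parametrization `ι : ℂ^(q+1) → π ⊆ ℂⁿ`.
For `q ≥ n` every upper semicontinuous function qualifies. -/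
def IsQPsh {n : ℕ} (q : ℕ) (U : Set (EuclideanSpace ℂ (Fin n)))
    (u : EuclideanSpace ℂ (Fin n) → EReal) : Prop :=
  (∀ z ∈ U, u z ≠ ⊤) ∧ UpperSemicontinuousOn u U ∧
    (q < n → ∀ ι : EuclideanSpace ℂ (Fin (q + 1)) →ᵃⁱ[ℂ] EuclideanSpace ℂ (Fin n),
      IsSubpluriharmonic (ι ⁻¹' U) (u ∘ ι))

/-- The operator `∂/∂z_k = (∂/∂x_k - i ∂/∂y_k) / 2`. -/
def dz {n : ℕ} (k : Fin n) (f : EuclideanSpace ℂ (Fin n) → ℂ)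
    (z : EuclideanSpace ℂ (Fin n)) : ℂ :=
  (fderiv ℝ f z (EuclideanSpace.single k 1)
    - Complex.I * fderiv ℝ f z (EuclideanSpace.single k Complex.I)) / 2

/-- The operator `∂/∂z̄_k = (∂/∂x_k + i ∂/∂y_k) / 2`. -/
def dzbar {n : ℕ} (k : Fin n) (f : EuclideanSpace ℂ (Fin n) → ℂ)
    (z : EuclideanSpace ℂ (Fin n)) : ℂ :=
  (fderiv ℝ f z (EuclideanSpace.single k 1)
    + Complex.I * fderiv ℝ f z (EuclideanSpace.single k Complex.I)) / 2

/-- The complex Hessian `[∂²f / ∂z_k ∂z̄_ℓ]` of a real-valued function at the point `z`. -/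
def complexHessian {n : ℕ} (f : EuclideanSpace ℂ (Fin n) → ℝ)
    (z : EuclideanSpace ℂ (Fin n)) : Matrix (Fin n) (Fin n) ℂ :=
  Matrix.of fun k l => dz k (dzbar l (fun w => (f w : ℂ))) z

/-- The sup-convolution `y ↦ sup_{x ∈ X} (v x + Φ (y - x))`. -/
def supConv {n : ℕ} (X : Set (EuclideanSpace ℂ (Fin n)))
    (v Φ : EuclideanSpace ℂ (Fin n) → EReal) (y : EuclideanSpace ℂ (Fin n)) : EReal :=
  ⨆ x ∈ X, v x + Φ (y - x)

/-- The proper set of definition of the sup-convolution: the points `y` at which the supremum is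
attained at some point of `X`. -/
def properSet {n : ℕ} (X : Set (EuclideanSpace ℂ (Fin n)))
    (v Φ : EuclideanSpace ℂ (Fin n) → EReal) : Set (EuclideanSpace ℂ (Fin n)) :=
  {y | ∃ x ∈ X, supConv X v Φ y = v x + Φ (y - x)}

end

/-! Suppose a slice of `v - h + k`, with `v` the sup-convolution and `k` plurisubharmonic, violates
the maximum principle on a ball with centre `c`. A small `ε‖y - c‖²` can be added so that there is a
maximum at an interior point `y₀`. Let `x₀` attain the supremum defining `v (ι y₀)`, and put `w = ι
y₀ - x₀`. Then `v (x + w) ≥ u x + g x + Φ w` on `U`, with equality at `x₀`, so the maximum passes to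
`u` on the parallel slice through `x₀`, plus `g - h(· + w)`, plus `k` and the quadratic term. Since
`g` has Hessian at least `A` and `h` at most `A`, `g - h(· + w)` is plurisubharmonic. Expanding the
square about `y₀` leaves a real-linear (hence plurisubharmonic) term and `ε‖t‖²`; the latter makes
the maximum at `t = 0` strict once it is dropped, contradicting subpluriharmonicity of `u` on that
slice. The analytic input is `isContinuousPsh_of_leviForm_nonneg`; `leviForm_le_of_complexHessian`
turns the matrix inequalities into Levi form inequalities. -/

/-! ### Nonnegative Levi form implies the sub-mean value inequality. -/

open Set Metric MeasureTheory intervalIntegral Filter Topology in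
theorem hasDerivAt_intervalIntegral_of_continuousOn {S : Set ℝ} (hS : IsOpen S) {G G' : ℝ → ℝ → ℝ}
    {a b : ℝ} (hG' : ContinuousOn (Function.uncurry G') (S ×ˢ univ))
    (hGc : ContinuousOn (Function.uncurry G) (S ×ˢ univ))
    (hd : ∀ x ∈ S, ∀ t, HasDerivAt (fun y => G y t) (G' x t) x) {x : ℝ} (hx : x ∈ S) :
    HasDerivAt (fun y => ∫ t in a..b, G y t) (∫ t in a..b, G' x t) x := by
  have slice : ∀ {H : ℝ → ℝ → ℝ}, ContinuousOn (Function.uncurry H) (S ×ˢ univ) →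
      ∀ y ∈ S, Continuous (H y) := by
    intro H hH y hy
    exact hH.comp_continuous (f := fun t => (y, t)) (by fun_prop) (fun t => ⟨hy, mem_univ t⟩)
  obtain ⟨ε, hε, hεS⟩ := Metric.nhds_basis_closedBall.mem_iff.1 (hS.mem_nhds hx)
  have hK : IsCompact (closedBall x ε ×ˢ uIcc a b) := (isCompact_closedBall x ε).prod isCompact_uIcc
  obtain ⟨C, hC⟩ := hK.exists_bound_of_continuousOn
    (hG'.mono (prod_mono hεS (subset_univ _)))
  refine (hasDerivAt_integral_of_dominated_loc_of_deriv_le (bound := fun _ => C)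
    (closedBall_mem_nhds x hε) ?_ ((slice hGc x hx).intervalIntegrable _ _)
    (slice hG' x hx).aestronglyMeasurable ?_ (by simp) ?_).2
  · filter_upwards [hS.mem_nhds hx] with y hy
    exact (slice hGc y hy).aestronglyMeasurable
  · refine .of_forall fun t ht y hy => hC (y, t) ⟨hy, uIoc_subset_uIcc ht⟩
  · exact .of_forall fun t _ y hy => hd y (hεS hy) t

section

variable {E : Type*} [NormedAddCommGroup E] [NormedSpace ℂ E]

/-- Four times the Levi form of `F` at `z` in the direction `c`. -/
noncomputable def leviForm (F : E → ℝ) (z c : E) : ℝ :=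
  fderiv ℝ (fderiv ℝ F) z c c +
    fderiv ℝ (fderiv ℝ F) z (Complex.I • c) (Complex.I • c)

theorem hasDerivAt_fderiv_comp_apply {F : E → ℝ} {p q : ℝ → E} {p' q' : E} {t : ℝ}
    {B : E →L[ℝ] E →L[ℝ] ℝ} (hF : HasFDerivAt (fderiv ℝ F) B (p t)) (hp : HasDerivAt p p' t)
    (hq : HasDerivAt q q' t) :
    HasDerivAt (fun s => fderiv ℝ F (p s) (q s)) (B p' (q t) + fderiv ℝ F (p t) q') t :=
  (hF.comp_hasDerivAt t hp).clm_apply hq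

-- With `φ r` the integral of `F` over the circle of radius `r`, the polar form of the Laplacian
-- gives `(r φ')' = r ∫ leviForm F ≥ 0`. So `r φ'` increases from `0`, and `φ` is monotone.
open Set Metric MeasureTheory intervalIntegral Filter Topology in
theorem isContinuousPsh_of_leviForm_nonneg {V : Set E} (hV : IsOpen V) {F : E → ℝ}
    (hF : ContDiffOn ℝ 2 F V) (hL : ∀ z ∈ V, ∀ c, 0 ≤ leviForm F z c) :
    IsContinuousPsh V F := by
  refine ⟨hF.continuousOn, fun a b hab => ?_⟩
  set e : ℝ → E := fun t => Complex.exp (t * Complex.I) • b with he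
  have he_cont : Continuous e := by fun_prop
  have he_deriv : ∀ t, HasDerivAt e (Complex.I • e t) t := by
    intro t
    have h1 : HasDerivAt (fun t : ℝ => Complex.exp (t * Complex.I))
        (Complex.exp (t * Complex.I) * (1 * Complex.I)) t :=
      ((Complex.ofRealCLM.hasDerivAt (x := t)).mul_const Complex.I).cexp
    convert h1.smul_const b using 1
    simp only [he, smul_smul]
    congr 1
    ring
  have hie_deriv : ∀ t, HasDerivAt (fun t => Complex.I • e t) (-e t) t := by
    intro t
    have h1 := (he_deriv t).const_smul Complex.I
    rw [smul_smul, Complex.I_mul_I, neg_one_smul] at h1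
    exact h1
  set p : ℝ → ℝ → E := fun r t => a + r • e t with hp
  have hpV : ∀ r ∈ Icc (-1 : ℝ) 1, ∀ t, p r t ∈ V := by
    intro r hr t
    have := hab (r * Complex.exp (t * Complex.I)) (by
      rw [norm_mul, Complex.norm_exp_ofReal_mul_I, mul_one, Complex.norm_real]
      exact abs_le.2 hr)
    simpa [hp, he, mul_smul] using this
  have hp_cont : Continuous (Function.uncurry p) := by
    change Continuous fun x : ℝ × ℝ => a + x.1 • e x.2
    fun_prop
  have hpr : ∀ r t, HasDerivAt (fun r => p r t) (e t) r := by
    intro r t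
    have h1 := ((hasDerivAt_id r).smul_const (e t)).const_add a
    rw [one_smul] at h1
    exact h1
  have hpt : ∀ r t, HasDerivAt (fun t => p r t) (r • Complex.I • e t) t := by
    intro r t
    exact ((he_deriv t).const_smul r).const_add a
  have hF1 : ContDiffOn ℝ 1 (fderiv ℝ F) V := hF.fderiv_of_isOpen hV (by norm_num)
  have hF2 : ContinuousOn (fderiv ℝ (fderiv ℝ F)) V :=
    hF1.continuousOn_fderiv_of_isOpen hV le_rfl
  have dF : ∀ z ∈ V, HasFDerivAt F (fderiv ℝ F z) z := fun z hz =>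
    ((hF.contDiffAt (hV.mem_nhds hz)).differentiableAt (by norm_num)).hasFDerivAt
  have dF1 : ∀ z ∈ V, HasFDerivAt (fderiv ℝ F) (fderiv ℝ (fderiv ℝ F) z) z := fun z hz =>
    ((hF1.contDiffAt (hV.mem_nhds hz)).differentiableAt (by norm_num)).hasFDerivAt
  -- Negative radii are allowed so that `r = 0` is an interior point for differentiation.
  set S : Set ℝ := Ioo (-1 : ℝ) 1 with hSdef
  have hS : IsOpen S := isOpen_Ioo
  have hpS : ∀ r ∈ S, ∀ t, p r t ∈ V := fun r hr => hpV r (Ioo_subset_Icc_self hr)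
  have hmaps : MapsTo (Function.uncurry p) (S ×ˢ univ) V := fun x hx => hpS x.1 hx.1 x.2
  have c0 : ContinuousOn (Function.uncurry fun r t => F (p r t)) (S ×ˢ univ) :=
    hF.continuousOn.comp hp_cont.continuousOn hmaps
  have c1' := hF1.continuousOn.comp hp_cont.continuousOn hmaps
  have c2' := hF2.comp hp_cont.continuousOn hmaps
  have ce : ContinuousOn (fun x : ℝ × ℝ => e x.2) (S ×ˢ univ) := by fun_prop
  have cie : ContinuousOn (fun x : ℝ × ℝ => Complex.I • e x.2) (S ×ˢ univ) := by fun_prop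
  have c1 : ContinuousOn (Function.uncurry fun r t => fderiv ℝ F (p r t) (e t)) (S ×ˢ univ) :=
    c1'.clm_apply ce
  have c2 : ContinuousOn (Function.uncurry fun r t =>
      fderiv ℝ (fderiv ℝ F) (p r t) (e t) (e t)) (S ×ˢ univ) :=
    (c2'.clm_apply ce).clm_apply ce
  have c3 : ContinuousOn (Function.uncurry fun r t =>
      fderiv ℝ (fderiv ℝ F) (p r t) (Complex.I • e t) (Complex.I • e t)) (S ×ˢ univ) :=
    (c2'.clm_apply cie).clm_apply cie
  have slice : ∀ {H : ℝ → ℝ → ℝ}, ContinuousOn (Function.uncurry H) (S ×ˢ univ) →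
      ∀ y ∈ S, Continuous (H y) := by
    intro H hH y hy
    exact hH.comp_continuous (f := fun t => (y, t)) (by fun_prop) (fun t => ⟨hy, mem_univ t⟩)
  set φ : ℝ → ℝ := fun r => ∫ t in (0)..(2 * Real.pi), F (p r t) with hφ
  set φ₁ : ℝ → ℝ := fun r => ∫ t in (0)..(2 * Real.pi), fderiv ℝ F (p r t) (e t) with hφ₁
  set φ₂ : ℝ → ℝ := fun r => ∫ t in (0)..(2 * Real.pi),
    fderiv ℝ (fderiv ℝ F) (p r t) (e t) (e t) with hφ₂
  have d1 : ∀ r ∈ S, HasDerivAt φ (φ₁ r) r := by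
    intro r hr
    refine hasDerivAt_intervalIntegral_of_continuousOn hS c1 c0 (fun x hx t => ?_) hr
    exact (dF _ (hpS x hx t)).comp_hasDerivAt x (hpr x t)
  have d2 : ∀ r ∈ S, HasDerivAt φ₁ (φ₂ r) r := by
    intro r hr
    refine hasDerivAt_intervalIntegral_of_continuousOn hS c2 c1 (fun x hx t => ?_) hr
    have h1 := hasDerivAt_fderiv_comp_apply (p := fun y => p y t) (dF1 _ (hpS x hx t)) (hpr x t)
      (hasDerivAt_const x (e t))
    rw [map_zero, add_zero] at h1
    exact h1
  -- The angular derivative of `fderiv ℝ F (p r t) (I • e t)` has zero integral over a period; this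
  -- trades the tangential second derivative for the radial first one.
  have key : ∀ r ∈ S, r * (∫ t in (0)..(2 * Real.pi),
      fderiv ℝ (fderiv ℝ F) (p r t) (Complex.I • e t) (Complex.I • e t)) = φ₁ r := by
    intro r hr
    have hd : ∀ t ∈ uIcc (0 : ℝ) (2 * Real.pi),
        HasDerivAt (fun t => fderiv ℝ F (p r t) (Complex.I • e t))
        (r * fderiv ℝ (fderiv ℝ F) (p r t) (Complex.I • e t) (Complex.I • e t)
          - fderiv ℝ F (p r t) (e t)) t := by
      intro t _
      have := hasDerivAt_fderiv_comp_apply (dF1 _ (hpS r hr t)) (hpt r t) (hie_deriv t)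
      rw [map_neg, ← sub_eq_add_neg, map_smul (fderiv ℝ (fderiv ℝ F) (p r t)) r,
        smul_apply, smul_eq_mul] at this
      exact this
    have i1 : IntervalIntegrable (fun t => r * fderiv ℝ (fderiv ℝ F) (p r t)
        (Complex.I • e t) (Complex.I • e t)) volume 0 (2 * Real.pi) :=
      ((slice c3 r hr).const_mul r).intervalIntegrable _ _
    have i2 := (slice c1 r hr).intervalIntegrable (μ := volume) 0 (2 * Real.pi)
    have := integral_eq_sub_of_hasDerivAt hd (i1.sub i2)
    have hper : e (2 * Real.pi) = e 0 := by simp [he]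
    have hper' : p r (2 * Real.pi) = p r 0 := by simp only [hp, hper]
    rw [integral_sub i1 i2, intervalIntegral.integral_const_mul, hper, hper', sub_self] at this
    exact sub_eq_zero.1 this
  have pos : ∀ r ∈ S, 0 ≤ r → 0 ≤ φ₁ r + r * φ₂ r := by
    intro r hr hr0
    rw [← key r hr, ← mul_add, ← integral_add ((slice c3 r hr).intervalIntegrable _ _)
      ((slice c2 r hr).intervalIntegrable _ _)]
    refine mul_nonneg hr0 (integral_nonneg (by positivity) fun t _ => ?_)
    rw [add_comm]
    exact hL _ (hpS r hr t) _
  have sub : Ico (0 : ℝ) 1 ⊆ S := fun r hr => ⟨by linarith [hr.1], hr.2⟩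
  have dψ : ∀ r ∈ S, HasDerivAt (fun r => r * φ₁ r) (φ₁ r + r * φ₂ r) r := by
    intro r hr
    have h1 := (hasDerivAt_id r).mul (d2 r hr)
    rw [one_mul] at h1
    exact h1
  have mono : MonotoneOn (fun r => r * φ₁ r) (Ico 0 1) := by
    refine monotoneOn_of_deriv_nonneg (convex_Ico 0 1)
      (fun r hr => (dψ r (sub hr)).continuousAt.continuousWithinAt)
      (fun r hr => (dψ r (sub (interior_subset hr))).differentiableAt.differentiableWithinAt) ?_
    intro r hr
    have hr' := interior_subset hr
    rw [(dψ r (sub hr')).deriv]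
    exact pos r (sub hr') hr'.1
  have φ₁_nonneg : ∀ r ∈ Ioo (0 : ℝ) 1, 0 ≤ φ₁ r := by
    intro r hr
    have := mono ⟨le_rfl, one_pos⟩ ⟨hr.1.le, hr.2⟩ hr.1.le
    simp only [zero_mul] at this
    exact nonneg_of_mul_nonneg_right this hr.1
  -- Continuity alone carries the monotonicity up to the unit circle `r = 1`.
  have φ_cont : ContinuousOn φ (Icc 0 1) := by
    rw [continuousOn_iff_continuous_domRestrict]
    refine intervalIntegral.continuous_parametric_intervalIntegral_of_continuous'
      (f := fun (r : Icc (0 : ℝ) 1) t => F (p r t)) ?_ _ _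
    refine hF.continuousOn.comp_continuous (f := fun x : Icc (0 : ℝ) 1 × ℝ => p x.1 x.2) ?_
      fun x => hpV x.1 ⟨by linarith [x.1.2.1], x.1.2.2⟩ x.2
    exact hp_cont.comp (f := fun x : Icc (0 : ℝ) 1 × ℝ => ((x.1 : ℝ), x.2)) (by fun_prop)
  have φ_mono : MonotoneOn φ (Icc 0 1) := by
    refine monotoneOn_of_deriv_nonneg (convex_Icc 0 1) φ_cont ?_ ?_
    · rw [interior_Icc]
      exact fun r hr => (d1 r (sub ⟨hr.1.le, hr.2⟩)).differentiableAt.differentiableWithinAt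
    · rw [interior_Icc]
      intro r hr
      rw [(d1 r (sub ⟨hr.1.le, hr.2⟩)).deriv]
      exact φ₁_nonneg r hr
  have h01 := φ_mono (left_mem_Icc.2 zero_le_one) (right_mem_Icc.2 zero_le_one) zero_le_one
  have hφ0 : φ 0 = 2 * Real.pi * F a := by simp [hφ, hp]
  have hφ1 : Real.circleAverage (fun ζ : ℂ => F (a + ζ • b)) 0 1 = (2 * Real.pi)⁻¹ * φ 1 := by
    simp [Real.circleAverage_def, circleMap, hφ, hp, he]
  rw [hφ1]
  rw [hφ0] at h01
  have hpi : 0 < 2 * Real.pi := by positivity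
  rw [inv_mul_eq_div, le_div_iff₀ hpi, mul_comm]
  exact h01

end

/-! ### Operations on plurisubharmonic functions and on Levi forms. -/

section

variable {E : Type*} [NormedAddCommGroup E] [NormedSpace ℂ E]

theorem IsContinuousPsh.circleIntegrable {V : Set E} {f : E → ℝ} (hf : IsContinuousPsh V f)
    {a b : E} (hab : ∀ ζ : ℂ, ‖ζ‖ ≤ 1 → a + ζ • b ∈ V) :
    CircleIntegrable (fun ζ : ℂ => f (a + ζ • b)) 0 1 := by
  refine ContinuousOn.circleIntegrable zero_le_one ?_
  refine hf.1.comp (by fun_prop) fun ζ hζ => hab ζ ?_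
  rw [mem_sphere_zero_iff_norm] at hζ
  exact hζ.le

theorem IsContinuousPsh.add {V : Set E} {f g : E → ℝ} (hf : IsContinuousPsh V f)
    (hg : IsContinuousPsh V g) : IsContinuousPsh V (fun z => f z + g z) := by
  refine ⟨hf.1.add hg.1, fun a b hab => ?_⟩
  rw [Real.circleAverage_fun_add (hf.circleIntegrable hab) (hg.circleIntegrable hab)]
  exact add_le_add (hf.2 a b hab) (hg.2 a b hab)

theorem IsContinuousPsh.mono {V V' : Set E} {f : E → ℝ} (hf : IsContinuousPsh V f)
    (h : V' ⊆ V) : IsContinuousPsh V' f :=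
  ⟨hf.1.mono h, fun a b hab => hf.2 a b fun ζ hζ => h (hab ζ hζ)⟩

theorem IsContinuousPsh.comp_add_linear {E' : Type*} [NormedAddCommGroup E'] [NormedSpace ℂ E']
    {V : Set E} {f : E → ℝ} (hf : IsContinuousPsh V f) (x : E) (L : E' →L[ℂ] E) :
    IsContinuousPsh {t | x + L t ∈ V} (fun t => f (x + L t)) := by
  refine ⟨hf.1.comp (by fun_prop) fun t ht => ht, fun a b hab => ?_⟩
  have hL : ∀ ζ : ℂ, x + L (a + ζ • b) = x + L a + ζ • L b := by
    intro ζ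
    rw [map_add, map_smul, add_assoc]
  simp only [Set.mem_ofPred_eq, hL] at hab
  simp only [hL]
  exact hf.2 (x + L a) (L b) hab

theorem isContinuousPsh_realLinear (ℓ : E →L[ℝ] ℝ) (V : Set E) :
    IsContinuousPsh V ℓ := by
  refine IsContinuousPsh.mono (V := Set.univ) ?_ (Set.subset_univ _)
  refine isContinuousPsh_of_leviForm_nonneg isOpen_univ ℓ.contDiff.contDiffOn fun z _ c => ?_
  have : fderiv ℝ (⇑ℓ) = fun _ => ℓ := funext fun z => ℓ.fderiv
  simp [leviForm, this]

theorem leviForm_sub {F G : E → ℝ} {z : E} (hF : ContDiffAt ℝ 2 F z) (hG : ContDiffAt ℝ 2 G z)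
    (c : E) : leviForm (fun x => F x - G x) z c = leviForm F z c - leviForm G z c := by
  have e : fderiv ℝ (fun x => F x - G x) =ᶠ[nhds z] fun x => fderiv ℝ F x - fderiv ℝ G x := by
    filter_upwards [hF.eventually (by simp), hG.eventually (by simp)] with x hx hy
    exact fderiv_fun_sub (hx.differentiableAt (by norm_num)) (hy.differentiableAt (by norm_num))
  have dF := (hF.fderiv_right (m := 1) (by norm_num)).differentiableAt (by norm_num)
  have dG := (hG.fderiv_right (m := 1) (by norm_num)).differentiableAt (by norm_num)
  unfold leviForm
  rw [e.fderiv_eq, fderiv_fun_sub dF dG]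
  simp only [sub_apply]
  ring

theorem leviForm_comp_add_right (F : E → ℝ) (w z c : E) :
    leviForm (fun x => F (x + w)) z c = leviForm F (z + w) c := by
  have e : fderiv ℝ (fun x => F (x + w)) = fun x => fderiv ℝ F (x + w) :=
    funext fun x => fderiv_comp_add_right w
  unfold leviForm
  rw [e, fderiv_comp_add_right]

end

/-! ### The complex Hessian as the matrix of the Levi form. -/

section

variable {n : ℕ}

local notation "𝔼" => EuclideanSpace ℂ (Fin n)

theorem complexHessian_apply {f : 𝔼 → ℝ} {z : 𝔼} (hf : ContDiffAt ℝ 2 f z) (k l : Fin n) :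
    complexHessian f z k l =
      ((fderiv ℝ (fderiv ℝ f) z (.single k 1) (.single l 1)
          + Complex.I * fderiv ℝ (fderiv ℝ f) z (.single k 1) (.single l Complex.I))
        - Complex.I * (fderiv ℝ (fderiv ℝ f) z (.single k Complex.I) (.single l 1)
          + Complex.I * fderiv ℝ (fderiv ℝ f) z (.single k Complex.I) (.single l Complex.I))) / 4 := by
  have d2 := (hf.fderiv_right (m := 1) (by norm_num)).differentiableAt (by norm_num)
  have e : dzbar l (fun w => (f w : ℂ)) =ᶠ[nhds z] fun w =>
      ((fderiv ℝ f w (.single l 1) : ℂ) + Complex.I * (fderiv ℝ f w (.single l Complex.I) : ℂ)) / 2 := by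
    filter_upwards [hf.eventually (by simp)] with w hw
    have := (Complex.ofRealCLM.hasFDerivAt.comp w
      (hw.differentiableAt (by norm_num)).hasFDerivAt).fderiv
    change fderiv ℝ (fun w => (f w : ℂ)) w = _ at this
    simp [dzbar, this]
  have h1 : ∀ v : 𝔼, HasFDerivAt (fun w => ((fderiv ℝ f w v : ℝ) : ℂ))
      (Complex.ofRealCLM ∘L ((fderiv ℝ (fderiv ℝ f) z).flip v)) z := fun v =>
    Complex.ofRealCLM.hasFDerivAt.comp z
      ((ContinuousLinearMap.apply ℝ ℝ v).hasFDerivAt.comp z d2.hasFDerivAt)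
  have h2 := (((h1 (.single l 1)).add ((h1 (.single l Complex.I)).const_mul Complex.I)).mul_const
    (2⁻¹ : ℂ))
  have h3 := h2.fderiv
  change fderiv ℝ (fun w => ((fderiv ℝ f w (.single l 1) : ℂ)
    + Complex.I * (fderiv ℝ f w (.single l Complex.I) : ℂ)) * 2⁻¹) z = _ at h3
  simp only [← div_eq_mul_inv] at h3
  simp only [complexHessian, Matrix.of_apply, dz, e.fderiv_eq, h3]
  simp
  ring

/-- The form `Λ` built from `B` is linear in the first slot and conjugate-linear in the second, so
it expands over the standard basis; on the diagonal the symmetry of `B` cancels the imaginary cross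
terms. -/
theorem sum_sesquilinear_complexification (B : 𝔼 →L[ℝ] 𝔼 →L[ℝ] ℝ) (hB : ∀ v w, B v w = B w v) (c : 𝔼) :
    ∑ k, ∑ l, c k * star (c l) *
      (((B (.single k 1) (.single l 1)
          + Complex.I * B (.single k 1) (.single l Complex.I))
        - Complex.I * (B (.single k Complex.I) (.single l 1)
          + Complex.I * B (.single k Complex.I) (.single l Complex.I))) / 4) =
      ((B c c + B (Complex.I • c) (Complex.I • c)) / 4 : ℝ) := by
  set Λ : 𝔼 → 𝔼 → ℂ := fun v w => (B v w + Complex.I * B v (Complex.I • w))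
    - Complex.I * (B (Complex.I • v) w + Complex.I * B (Complex.I • v) (Complex.I • w)) with hΛ
  have real_smul : ∀ (r : ℝ) (v : 𝔼), (r : ℂ) • v = r • v := fun r v => Complex.coe_smul r v
  have split : ∀ (a : ℂ) (v : 𝔼), a • v = a.re • v + a.im • (Complex.I • v) := by
    intro a v
    conv_lhs => rw [← Complex.re_add_im a]
    rw [add_smul, mul_smul, real_smul, real_smul]
  have split' : ∀ (a : ℂ) (v : 𝔼),
      Complex.I • (a • v) = a.re • (Complex.I • v) - a.im • v := by
    intro a v
    rw [smul_comm, split a (Complex.I • v), smul_smul Complex.I, Complex.I_mul_I, neg_one_smul,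
      smul_neg, sub_eq_add_neg]
  have add_left : ∀ v v' w, Λ (v + v') w = Λ v w + Λ v' w := by
    intro v v' w
    simp [hΛ]; ring
  have add_right : ∀ v w w', Λ v (w + w') = Λ v w + Λ v w' := by
    intro v v' w
    simp [hΛ]; ring
  have smul_left : ∀ (a : ℂ) v w, Λ (a • v) w = a * Λ v w := by
    intro a v w
    simp only [hΛ]
    rw [split' a v, split a v]
    simp only [map_add, map_sub, map_smul, add_apply, sub_apply, smul_apply, smul_eq_mul]
    push_cast
    conv_rhs => rw [← Complex.re_add_im a]
    linear_combination (a.im * (B (Complex.I • v) w : ℂ)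
      + a.im * Complex.I * (B (Complex.I • v) (Complex.I • w) : ℂ)) * Complex.I_mul_I
  have smul_right : ∀ (a : ℂ) v w, Λ v (a • w) = star a * Λ v w := by
    intro a v w
    have ha : star a = a.re - a.im * Complex.I := by
      apply Complex.ext <;> simp
    simp only [hΛ]
    rw [split' a w, split a w, ha]
    simp only [map_add, map_sub, map_smul, smul_eq_mul]
    push_cast
    linear_combination (a.im * (B v (Complex.I • w) : ℂ)
      - a.im * Complex.I * (B (Complex.I • v) (Complex.I • w) : ℂ)) * Complex.I_mul_I
  have hI : ∀ k : Fin n, Complex.I • (EuclideanSpace.single k (1 : ℂ)) =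
      EuclideanSpace.single k Complex.I := by
    intro k
    ext i
    simp
  have hc : c = ∑ k, c k • EuclideanSpace.single k (1 : ℂ) := by
    ext i
    simp [Pi.single_apply]
  have sum_left : ∀ (s : Finset (Fin n)) (f : Fin n → 𝔼) w,
      Λ (∑ k ∈ s, f k) w = ∑ k ∈ s, Λ (f k) w := by
    intro s f w
    exact map_sum (AddMonoidHom.mk' (fun v => Λ v w) fun v v' => add_left v v' w) f s
  have sum_right : ∀ (s : Finset (Fin n)) (f : Fin n → 𝔼) v,
      Λ v (∑ k ∈ s, f k) = ∑ k ∈ s, Λ v (f k) := by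
    intro s f v
    exact map_sum (AddMonoidHom.mk' (fun w => Λ v w) fun w w' => add_right v w w') f s
  have main : Λ c c = ∑ k, ∑ l, c k * star (c l) *
      Λ (EuclideanSpace.single k 1) (EuclideanSpace.single l 1) := by
    conv_lhs => rw [hc]
    simp only [sum_left, sum_right, smul_left, smul_right, mul_assoc]
  have diag : Λ c c = ((B c c + B (Complex.I • c) (Complex.I • c) : ℝ) : ℂ) := by
    simp only [hΛ]
    rw [hB c (Complex.I • c)]
    push_cast
    linear_combination (-(B (Complex.I • c) (Complex.I • c) : ℂ)) * Complex.I_mul_I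
  push_cast
  push_cast at diag
  rw [← diag, main, Finset.sum_div]
  refine Finset.sum_congr rfl fun k _ => ?_
  rw [Finset.sum_div]
  refine Finset.sum_congr rfl fun l _ => ?_
  simp only [hΛ, hI]
  ring

/-- The conjugated vector appears because the row index of the Hessian carries `∂/∂z_k`, while
`star` conjugates the left factor. -/
theorem dotProduct_complexHessian {f : 𝔼 → ℝ} {z : 𝔼} (hf : ContDiffAt ℝ 2 f z) (c : 𝔼) :
    star (fun k => star (c k)) ⬝ᵥ (complexHessian f z).mulVec (fun k => star (c k)) =
      ((leviForm f z c / 4 : ℝ) : ℂ) := by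
  have hB : ∀ v w, fderiv ℝ (fderiv ℝ f) z v w = fderiv ℝ (fderiv ℝ f) z w v := by
    intro v w
    exact (hf.isSymmSndFDerivAt (by simp)) v w
  rw [leviForm, ← sum_sesquilinear_complexification _ hB c]
  simp only [dotProduct, Matrix.mulVec, Finset.mul_sum, Pi.star_apply, star_star,
    complexHessian_apply hf]
  refine Finset.sum_congr rfl fun k _ => Finset.sum_congr rfl fun l _ => ?_
  ring

theorem leviForm_le_of_complexHessian {A : Matrix (Fin n) (Fin n) ℂ} {g h : 𝔼 → ℝ} {z w : 𝔼}
    (hg : ContDiffAt ℝ 2 g z) (hh : ContDiffAt ℝ 2 h w)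
    (hgA : (complexHessian g z - A).PosSemidef) (hhA : (A - complexHessian h w).PosSemidef)
    (c : 𝔼) : leviForm h w c ≤ leviForm g z c := by
  have h1 := (hgA.add hhA).dotProduct_mulVec_nonneg (fun k => star (c k))
  rw [sub_add_sub_cancel, Matrix.sub_mulVec, dotProduct_sub, dotProduct_complexHessian hg,
    dotProduct_complexHessian hh, ← Complex.ofReal_sub, Complex.zero_le_real] at h1
  linarith

end

/-! ### Perturbing an interior maximum. -/

theorem UpperSemicontinuousOn.add_coe_ereal {X : Type*} [TopologicalSpace X] {s : Set X}
    {f : X → EReal} {g : X → ℝ} (hf : UpperSemicontinuousOn f s) (hg : ContinuousOn g s) :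
    UpperSemicontinuousOn (fun x => f x + (g x : EReal)) s := by
  refine hf.add' (continuous_coe_real_ereal.comp_continuousOn hg).upperSemicontinuousOn
    fun x _ => ?_
  exact EReal.continuousAt_add (Or.inr (EReal.coe_ne_bot _)) (Or.inr (EReal.coe_ne_top _))

open Metric in
/-- If an upper semicontinuous function has no maximum over a ball on the bounding sphere, then a
small multiple of `‖y - c‖ ^ 2` can be added so that the maximum is still at an interior point. -/
theorem exists_interior_max_add_normSq {E : Type*} [NormedAddCommGroup E] [ProperSpace E]
    {f : E → EReal} {c : E} {r : ℝ} (hr : 0 < r) (hne : (sphere c r).Nonempty)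
    (hf : UpperSemicontinuousOn f (closedBall c r)) (hf_top : ∀ z ∈ closedBall c r, f z ≠ ⊤)
    (hmax : ¬ ∃ p ∈ sphere c r, ∀ z ∈ closedBall c r, f z ≤ f p) :
    ∃ ε > 0, ∃ y₀ ∈ ball c r, f y₀ ≠ ⊥ ∧ ∀ y ∈ closedBall c r,
      f y + ((ε * ‖y - c‖ ^ 2 : ℝ) : EReal) ≤ f y₀ + ((ε * ‖y₀ - c‖ ^ 2 : ℝ) : EReal) := by
  obtain ⟨p, hp, hpmax⟩ := UpperSemicontinuousOn.exists_isMaxOn hne (isCompact_sphere c r)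
    (hf.mono sphere_subset_closedBall)
  push Not at hmax
  obtain ⟨z, hz, hpz⟩ := hmax p hp
  obtain ⟨S, hpS, hSz⟩ := EReal.lt_iff_exists_real_btwn.1 hpz
  obtain ⟨M, hM⟩ : ∃ M : ℝ, f z = M :=
    ⟨(f z).toReal, (EReal.coe_toReal (hf_top z hz) (bot_lt_iff_ne_bot.1 (bot_le.trans_lt hpz))).symm⟩
  rw [hM, EReal.coe_lt_coe_iff] at hSz
  -- This coefficient adds exactly `(M - S) / 2` on the sphere, where `f < S`, so values there stay
  -- below `M = f z`.
  obtain ⟨y₀, hy₀, hmax₀⟩ := UpperSemicontinuousOn.exists_isMaxOn (nonempty_closedBall.2 hr.le)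
    (isCompact_closedBall c r) (hf.add_coe_ereal (g := fun y => (M - S) / (2 * r ^ 2) * ‖y - c‖ ^ 2)
      (by fun_prop))
  have hε : 0 < (M - S) / (2 * r ^ 2) := div_pos (sub_pos.2 hSz) (by positivity)
  have hMy₀ : (M : EReal) ≤ f y₀ + (((M - S) / (2 * r ^ 2) * ‖y₀ - c‖ ^ 2 : ℝ) : EReal) := by
    refine le_trans ?_ (hmax₀ hz)
    change (M : EReal) ≤ f z + _
    rw [hM, ← EReal.coe_add, EReal.coe_le_coe_iff]
    have : 0 ≤ (M - S) / (2 * r ^ 2) * ‖z - c‖ ^ 2 := by positivity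
    linarith
  have hbot : f y₀ ≠ ⊥ := by
    intro h
    rw [h, EReal.bot_add, le_bot_iff] at hMy₀
    exact EReal.coe_ne_bot _ hMy₀
  refine ⟨(M - S) / (2 * r ^ 2), hε, y₀, ?_, hbot, fun y hy => hmax₀ hy⟩
  by_contra hnot
  have hs : y₀ ∈ sphere c r := by
    rw [mem_sphere]
    rw [mem_ball, not_lt] at hnot
    exact le_antisymm hy₀ hnot
  have hle : f y₀ < S := (hpmax hs).trans_lt hpS
  rw [mem_sphere_iff_norm.1 hs] at hMy₀
  obtain ⟨b, hb⟩ : ∃ b : ℝ, f y₀ = b := ⟨(f y₀).toReal, (EReal.coe_toReal (hf_top y₀ hy₀) hbot).symm⟩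
  rw [hb, ← EReal.coe_add, EReal.coe_le_coe_iff] at hMy₀
  rw [hb, EReal.coe_lt_coe_iff] at hle
  have : (M - S) / (2 * r ^ 2) * r ^ 2 = (M - S) / 2 := by
    field_simp
  linarith

/-! ### The sup-convolution theorem. -/

open Metric in
theorem mainTheorem2 {n : ℕ} (q : ℕ)
    (Φ : EuclideanSpace ℂ (Fin n) → EReal)
    (hΦ_top : ∀ x, Φ x ≠ ⊤) (hΦ : UpperSemicontinuous Φ)
    (U : Set (EuclideanSpace ℂ (Fin n))) (hU : IsOpen U) (hU_ne : U.Nonempty)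
    (A : Matrix (Fin n) (Fin n) ℂ) (hA : A.IsHermitian)
    (g : EuclideanSpace ℂ (Fin n) → ℝ) (hg : ContDiffOn ℝ 2 g U)
    (hgA : ∀ z ∈ U, (complexHessian g z - A).PosSemidef)
    (u : EuclideanSpace ℂ (Fin n) → EReal) (hu : IsQPsh q U u)
    (W : Set (EuclideanSpace ℂ (Fin n)))
    (hW : W = interior (properSet U (fun x => u x + (g x : EReal)) Φ)) (hW_ne : W.Nonempty)
    (husc : UpperSemicontinuousOn (supConv U (fun x => u x + (g x : EReal)) Φ) W)
    (h : EuclideanSpace ℂ (Fin n) → ℝ) (hh : ContDiffOn ℝ 2 h W)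
    (hhA : ∀ z ∈ W, (A - complexHessian h z).PosSemidef) :
    IsQPsh q W (fun y => supConv U (fun x => u x + (g x : EReal)) Φ y - (h y : EReal)) := by
  set v := supConv U (fun x => u x + (g x : EReal)) Φ with hv
  have hWo : IsOpen W := hW ▸ isOpen_interior
  have hattained : ∀ y ∈ W, ∃ x ∈ U, v y = u x + (g x : EReal) + Φ (y - x) := by
    intro y hy
    rw [hW] at hy
    have hy' : y ∈ properSet U (fun x => u x + (g x : EReal)) Φ := interior_subset hy
    exact hy'
  have hle : ∀ x ∈ U, ∀ y, u x + (g x : EReal) + Φ (y - x) ≤ v y := fun x hx y =>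
    le_iSup₂ (f := fun x (_ : x ∈ U) => u x + (g x : EReal) + Φ (y - x)) x hx
  have hv_top : ∀ y ∈ W, v y ≠ ⊤ := by
    intro y hy
    obtain ⟨x, hx, hxy⟩ := hattained y hy
    rw [hxy]
    exact EReal.add_ne_top (EReal.add_ne_top (hu.1 x hx) (EReal.coe_ne_top _)) (hΦ_top _)
  have hvh_top : ∀ y ∈ W, v y - (h y : EReal) ≠ ⊤ := by
    intro y hy
    rw [sub_eq_add_neg, ← EReal.coe_neg]
    exact EReal.add_ne_top (hv_top y hy) (EReal.coe_ne_top _)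
  have hvh_usc : UpperSemicontinuousOn (fun y => v y - (h y : EReal)) W := by
    simp only [sub_eq_add_neg, ← EReal.coe_neg]
    exact husc.add_coe_ereal hh.continuousOn.neg
  -- A slice on which the function is `-∞` needs no separate case: every point of the sphere is then
  -- a maximum.
  refine ⟨hvh_top, hvh_usc, fun hq ι => Or.inr fun c r hr hball V k hV hcV hk => ?_⟩
  by_contra hmax
  obtain ⟨ε, hε, y₀, hy₀, hbot, hy₀max⟩ := exists_interior_max_add_normSq
    (f := fun z => v (ι z) - (h (ι z) : EReal) + (k z : EReal)) hr
    (NormedSpace.sphere_nonempty.2 hr.le)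
    (UpperSemicontinuousOn.add_coe_ereal
      (hvh_usc.comp ι.continuous.continuousOn hball)
      (hk.1.mono hcV))
    (fun z hz => EReal.add_ne_top (hvh_top _ (hball hz)) (EReal.coe_ne_top _)) hmax
  obtain ⟨x₀, hx₀, hvx₀⟩ := hattained (ι y₀) (hball (ball_subset_closedBall hy₀))
  set L := ι.linearIsometry with hL
  set w := ι y₀ - x₀ with hw
  have hι : ∀ t, ι (y₀ + t) = x₀ + L t + w := by
    intro t
    have := ι.map_vadd y₀ t
    rw [vadd_eq_add, vadd_eq_add, add_comm t y₀] at this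
    rw [this, hw]
    abel
  have hG : IsContinuousPsh (U ∩ {x | x + w ∈ W}) (fun x => g x - h (x + w)) := by
    have hcomp : ∀ x, x + w ∈ W → ContDiffAt ℝ 2 (fun x => h (x + w)) x := fun x hx =>
      ContDiffAt.comp x (hh.contDiffAt (hWo.mem_nhds hx)) (by fun_prop)
    refine isContinuousPsh_of_leviForm_nonneg
      (hU.inter (hWo.preimage (by fun_prop))) ?_ ?_
    · intro x hx
      exact ((hg.contDiffAt (hU.mem_nhds hx.1)).sub (hcomp x hx.2)).contDiffWithinAt
    · intro x hx b
      rw [leviForm_sub (hg.contDiffAt (hU.mem_nhds hx.1)) (hcomp x hx.2),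
        leviForm_comp_add_right, sub_nonneg]
      exact leviForm_le_of_complexHessian (hg.contDiffAt (hU.mem_nhds hx.1))
        (hh.contDiffAt (hWo.mem_nhds hx.2)) (hgA x hx.1) (hhA _ hx.2) b
  -- First-order part of `ε‖y₀ + t - c‖²` in `t`.
  set ℓ : EuclideanSpace ℂ (Fin (q + 1)) →L[ℝ] ℝ :=
    (2 * ε) • (Complex.reCLM ∘L ((innerSL ℂ (y₀ - c)).restrictScalars ℝ)) with hℓ
  set V₁ : Set (EuclideanSpace ℂ (Fin (q + 1))) :=
    {t | x₀ + L t ∈ U ∩ {x | x + w ∈ W}} ∩ {t | y₀ + t ∈ V} with hV₁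
  have hH : IsContinuousPsh V₁ (fun t => g (x₀ + L t) - h (x₀ + L t + w) + k (y₀ + t) + ℓ t) :=
    (((hG.comp_add_linear x₀ L.toContinuousLinearMap).mono Set.inter_subset_left).add
      ((hk.comp_add_linear y₀ (ContinuousLinearMap.id ℂ _)).mono Set.inter_subset_right)).add
      (isContinuousPsh_realLinear ℓ V₁)
  have hLc : Continuous L := L.continuous
  have hV₁o : IsOpen V₁ := by
    refine IsOpen.inter (IsOpen.preimage (f := fun t => x₀ + L t) (by fun_prop)
      (hU.inter (hWo.preimage (by fun_prop)))) (hV.preimage (by fun_prop))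
  have h0 : (0 : EuclideanSpace ℂ (Fin (q + 1))) ∈ V₁ ∩ {t | y₀ + t ∈ ball c r} := by
    refine ⟨⟨⟨by simpa using hx₀, ?_⟩, ?_⟩, by simpa using hy₀⟩
    · change x₀ + L 0 + w ∈ W
      rw [← hι, add_zero]
      exact hball (ball_subset_closedBall hy₀)
    · change y₀ + 0 ∈ V
      rw [add_zero]
      exact hcV (ball_subset_closedBall hy₀)
  obtain ⟨δ, hδ, hδV⟩ := nhds_basis_closedBall.mem_iff.1
    ((hV₁o.inter (isOpen_ball.preimage (by fun_prop))).mem_nhds h0)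
  set ι' : EuclideanSpace ℂ (Fin (q + 1)) →ᵃⁱ[ℂ] EuclideanSpace ℂ (Fin n) :=
    (AffineIsometryEquiv.constVAdd ℂ _ x₀).toAffineIsometry.comp L.toAffineIsometry with hι'
  have hι'_apply : ∀ t, ι' t = x₀ + L t := fun t => rfl
  have hvx₀_bot : v (ι y₀) ≠ ⊥ := by
    intro hb
    apply hbot
    rw [hb, EReal.bot_sub, EReal.bot_add]
  have hux₀ : u x₀ ≠ ⊥ := by
    intro hb
    rw [hb, EReal.bot_add, EReal.bot_add] at hvx₀
    exact hvx₀_bot hvx₀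
  have hΦw : Φ w ≠ ⊥ := by
    intro hb
    rw [hb, EReal.add_bot] at hvx₀
    exact hvx₀_bot hvx₀
  lift u x₀ to ℝ using ⟨hu.1 x₀ hx₀, hux₀⟩ with a ha
  rcases hu.2.2 hq ι' with hu' | hu'
  · have := hu' 0 (by simpa [hι'_apply] using hx₀)
    simp only [Function.comp_apply, hι'_apply, map_zero, add_zero, ← ha] at this
    exact EReal.coe_ne_bot _ this
  obtain ⟨p, hp, hpmax⟩ := hu' 0 δ hδ (fun t ht => (hδV ht).1.1.1) V₁ _ hV₁o
    (fun t ht => (hδV ht).1) hH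
  have hpδ := hδV (sphere_subset_closedBall hp)
  have hpU : x₀ + L p ∈ U := hpδ.1.1.1
  have hpW : ι (y₀ + p) ∈ W := hι p ▸ hpδ.1.1.2
  have hp0 := hpmax 0 (mem_closedBall_self hδ.le)
  simp only [Function.comp_apply, hι'_apply, map_zero, add_zero, ← ha] at hp0
  -- The value at the boundary maximum dominates the finite value at `0`; all terms can then be
  -- compared as real numbers.
  have hup : u (x₀ + L p) ≠ ⊥ := by
    intro hb
    rw [hb, EReal.bot_add, le_bot_iff, ← EReal.coe_add] at hp0
    exact EReal.coe_ne_bot _ hp0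
  have hvp := hle _ hpU (ι (y₀ + p))
  have hmaxp := hy₀max _ (ball_subset_closedBall hpδ.2)
  rw [hι p, add_sub_cancel_left] at hvp
  have hι0 := hι 0
  rw [add_zero, map_zero, add_zero] at hι0
  simp only [hι p] at hmaxp
  rw [hvx₀, hι0] at hmaxp
  lift u (x₀ + L p) to ℝ using ⟨hu.1 _ hpU, hup⟩ with b hb
  lift Φ w to ℝ using ⟨hΦ_top w, hΦw⟩ with φ hφ
  have hvp_bot : v (x₀ + L p + w) ≠ ⊥ := by
    intro hb
    rw [hb, le_bot_iff] at hvp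
    exact EReal.coe_ne_bot (b + g (x₀ + L p) + φ) (by push_cast; exact hvp)
  have hvp_top := hv_top _ hpW
  rw [hι p] at hvp_top
  lift v (x₀ + L p + w) to ℝ using ⟨hvp_top, hvp_bot⟩ with m hm
  norm_cast at hvp hp0 hmaxp
  have hnorm : ‖y₀ + p - c‖ ^ 2 = ‖y₀ - c‖ ^ 2 + 2 * (inner ℂ (y₀ - c) p).re + ‖p‖ ^ 2 := by
    rw [show y₀ + p - c = (y₀ - c) + p by abel]
    exact norm_add_sq (𝕜 := ℂ) _ _
  have hℓp : ℓ p = 2 * ε * (inner ℂ (y₀ - c) p).re := rfl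
  rw [hnorm] at hmaxp
  rw [hℓp] at hp0
  -- The leftover `ε δ²` makes the value at `p` strictly smaller than at `0`, against `hp0`.
  have hpos : 0 < ε * ‖p‖ ^ 2 := by
    rw [mem_sphere_zero_iff_norm.1 hp]
    positivity
  linarith
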